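/- Let $k$ be an algebraically closed field of characteristic zero and, for a commutative $k$-algebra $A$, let $I_A$ be the kernel of the multiplication map $A\otimes_k A\to A$. For an integer $n\ge 0$ let $\Omega_n(A)=I_A/I_A^{n+1}$, an $A$-module through the left tensor factor (the universal module of $n$-th order $k$-derivations of $A$), and let $d_n:A\to\Omega_n(A)$ send $a$ to the class of $1\otimes a-a\otimes 1$. Let $S=k[x_1,\dots,x_s]$ be a polynomial algebra, let $\mathfrak m$ be a maximal ideal of $S$, and let $f\in\mathfrak m$ be irreducible. Suppose that $d_n(x_1^{\alpha_1}\cdots x_s^{\alpha_s}f)\in\mathfrak m\,\Omega_n(S)$ whenever $0\le\alpha_1+\dots+\alpha_s\le n-1$. Put $R=S/(f)$, let $\overline{\mathfrak m}=\mathfrak m/(f)$, and let $N\subseteq\Omega_n(S)$ be the $S$-submodule generated by all $d_n(g)$ with $g\in fS$. Then $\overline{\mathfrak m}$ is a maximal ideal of $R$, and the localization at $\overline{\mathfrak m}$ of the sequence of canonical maps of $R$-modules $$0\to\frac{N+f\,\Omega_n(S)}{f\,\Omega_n(S)}\xrightarrow{\ \iota\ }\frac{\Omega_n(S)}{f\,\Omega_n(S)}\longrightarrow\Omega_n(R)\to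 0$$ is a minimal free resolution of the $R_{\overline{\mathfrak m}}$-module $\Omega_n(R)_{\overline{\mathfrak m}}$. That is, the localized sequence is exact; its first two terms after the initial $0$ are free $R_{\overline{\mathfrak m}}$-modules of finite rank, namely $\left(\frac{N+f\Omega_n(S)}{f\Omega_n(S)}\right)_{\overline{\mathfrak m}}$ of rank $\binom{n+s-1}{s}$ and $\left(\frac{\Omega_n(S)}{f\Omega_n(S)}\right)_{\overline{\mathfrak m}}$ of rank $\binom{n+s}{s}-1$; and the image of $\iota_{\overline{\mathfrak m}}$ is contained in $\overline{\mathfrak m}\left(\frac{\Omega_n(S)}{f\Omega_n(S)}\right)_{\overline{\mathfrak m}}$. -/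

import Mathlib

open scoped TensorProduct

/-- The universal module `Ω_n(A) = I / I ^ (n + 1)` of `n`-th order `k`-derivations of `A`, where
`I = KaehlerDifferential.ideal k A` is the kernel of the multiplication map `A ⊗[k] A → A`. -/
def UnivModule (k A : Type*) [CommRing k] [CommRing A] [Algebra k A] (n : ℕ) : Type _ :=
  KaehlerDifferential.ideal k A ⧸
    Submodule.submoduleOf (KaehlerDifferential.ideal k A ^ (n + 1)) (KaehlerDifferential.ideal k A)

namespace UnivModule

noncomputable section

instance instAddCommGroup (k A : Type*) [CommRing k] [CommRing A] [Algebra k A] (n : ℕ) :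
    AddCommGroup (UnivModule k A n) :=
  inferInstanceAs (AddCommGroup (KaehlerDifferential.ideal k A ⧸
    Submodule.submoduleOf (KaehlerDifferential.ideal k A ^ (n + 1)) (KaehlerDifferential.ideal k A)))

/-- `A` acts on `Ω_n(A)` through the left factor `a ↦ a ⊗ 1` of `A ⊗[k] A`. -/
instance instModule (k A : Type*) [CommRing k] [CommRing A] [Algebra k A] (n : ℕ) :
    Module A (UnivModule k A n) :=
  inferInstanceAs (Module A (KaehlerDifferential.ideal k A ⧸
    Submodule.submoduleOf (KaehlerDifferential.ideal k A ^ (n + 1)) (KaehlerDifferential.ideal k A)))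

/-- The class in `Ω_n(A)` of an element of `I`. -/
def mk (k A : Type*) [CommRing k] [CommRing A] [Algebra k A] (n : ℕ) :
    KaehlerDifferential.ideal k A →ₗ[A] UnivModule k A n :=
  (Submodule.mkQ (Submodule.submoduleOf (KaehlerDifferential.ideal k A ^ (n + 1))
    (KaehlerDifferential.ideal k A))).restrictScalars A

/-- The universal derivation of order `n`: `d_n(a)` is the class of `1 ⊗ a - a ⊗ 1`. -/
def d (k : Type*) {A : Type*} [CommRing k] [CommRing A] [Algebra k A] (n : ℕ) (a : A) :
    UnivModule k A n :=
  mk k A n ⟨(1 : A) ⊗ₜ[k] a - a ⊗ₜ[k] (1 : A),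
    KaehlerDifferential.one_smul_sub_smul_one_mem_ideal k a⟩

theorem map_mem_ideal {k A B : Type*} [CommRing k] [CommRing A] [Algebra k A] [CommRing B]
    [Algebra k B] (φ : A →ₐ[k] B) {x : A ⊗[k] A} (hx : x ∈ KaehlerDifferential.ideal k A) :
    Algebra.TensorProduct.map φ φ x ∈ KaehlerDifferential.ideal k B := by
  have h : ((Algebra.TensorProduct.lmul' k (S := B)).comp (Algebra.TensorProduct.map φ φ)) =
      φ.comp (Algebra.TensorProduct.lmul' k (S := A)) := by
    ext a <;> simp
  have hx' : Algebra.TensorProduct.lmul' k (S := A) x = 0 := hx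
  have h2 := DFunLike.congr_fun h x
  change Algebra.TensorProduct.lmul' k (S := B) (Algebra.TensorProduct.map φ φ x) = 0
  simpa [hx'] using h2

/-- The map `I_A → I_B` of kernels induced by `φ ⊗ φ`, for a `k`-algebra map `φ : A → B`. -/
def idealMap {k A B : Type*} [CommRing k] [CommRing A] [Algebra k A] [CommRing B]
    [Algebra k B] (φ : A →ₐ[k] B) :
    KaehlerDifferential.ideal k A →ₛₗ[(Algebra.TensorProduct.map φ φ : A ⊗[k] A →+* B ⊗[k] B)]
      KaehlerDifferential.ideal k B where
  toFun x := ⟨Algebra.TensorProduct.map φ φ x, map_mem_ideal φ x.2⟩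
  map_add' _ _ := Subtype.ext (map_add _ _ _)
  map_smul' _ _ := Subtype.ext (map_mul _ _ _)

theorem idealMap_le {k A B : Type*} [CommRing k] [CommRing A] [Algebra k A] [CommRing B]
    [Algebra k B] (φ : A →ₐ[k] B) (n : ℕ) :
    Submodule.submoduleOf (KaehlerDifferential.ideal k A ^ (n + 1)) (KaehlerDifferential.ideal k A) ≤
      (Submodule.submoduleOf (KaehlerDifferential.ideal k B ^ (n + 1))
        (KaehlerDifferential.ideal k B)).comap (idealMap φ) := by
  intro x hx
  have hx' : (x : A ⊗[k] A) ∈ KaehlerDifferential.ideal k A ^ (n + 1) := hx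
  change Algebra.TensorProduct.map φ φ (x : A ⊗[k] A) ∈ KaehlerDifferential.ideal k B ^ (n + 1)
  have h1 : (KaehlerDifferential.ideal k A).map (Algebra.TensorProduct.map φ φ) ≤
      KaehlerDifferential.ideal k B :=
    Ideal.map_le_iff_le_comap.2 fun y hy => map_mem_ideal φ hy
  have h2 := Ideal.mem_map_of_mem (Algebra.TensorProduct.map φ φ) hx'
  rw [Ideal.map_pow] at h2
  exact Ideal.pow_right_mono h1 (n + 1) h2

/-- The map `Ω_n(A) → Ω_n(B)` induced by a `k`-algebra map `φ : A → B`, semilinear along `φ`. -/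
def map {k A B : Type*} [CommRing k] [CommRing A] [Algebra k A] [CommRing B]
    [Algebra k B] (φ : A →ₐ[k] B) (n : ℕ) :
    UnivModule k A n →ₛₗ[(φ : A →+* B)] UnivModule k B n where
  toFun := Submodule.mapQ _ _ (idealMap φ) (idealMap_le φ n)
  map_add' := map_add _
  map_smul' a x := by
    obtain ⟨y, rfl⟩ := Submodule.mkQ_surjective _ x
    refine congrArg (mk k B n) (Subtype.ext ?_)
    change Algebra.TensorProduct.map φ φ (a • (y : A ⊗[k] A)) =
      φ a • Algebra.TensorProduct.map φ φ (y : A ⊗[k] A)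
    rw [Algebra.smul_def, Algebra.smul_def, map_mul]
    simp [Algebra.TensorProduct.algebraMap_apply]

/-- `Ω_n(A) / f Ω_n(A)`, which is a module over `A / (f)`. -/
abbrev Reduction (k : Type*) {A : Type*} [CommRing k] [CommRing A] [Algebra k A] (f : A) (n : ℕ) :
    Type _ :=
  UnivModule k A n ⧸ (Ideal.span {f} • ⊤ : Submodule A (UnivModule k A n))

/-- The submodule `N` of `Ω_n(A)` generated by all `d_n(g)` with `g ∈ f A`. -/
def N (k : Type*) {A : Type*} [CommRing k] [CommRing A] [Algebra k A] (f : A) (n : ℕ) :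
    Submodule A (UnivModule k A n) :=
  Submodule.span A (d k n '' (Ideal.span {f} : Ideal A))

/-- `(N + f Ω_n(A)) / f Ω_n(A)`, as an `A / (f)`-submodule of `Ω_n(A) / f Ω_n(A)`. -/
def relations (k : Type*) {A : Type*} [CommRing k] [CommRing A] [Algebra k A] (f : A) (n : ℕ) :
    Submodule (A ⧸ Ideal.span {f}) (Reduction k f n) where
  __ := ((N k f n ⊔ Ideal.span {f} • ⊤).map
    (Submodule.mkQ (Ideal.span {f} • ⊤ : Submodule A (UnivModule k A n)))).toAddSubmonoid
  smul_mem' c x hx := by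
    obtain ⟨a, rfl⟩ := Ideal.Quotient.mk_surjective c
    exact ((N k f n ⊔ Ideal.span {f} • ⊤).map
      (Submodule.mkQ (Ideal.span {f} • ⊤ : Submodule A (UnivModule k A n)))).smul_mem a hx

theorem smul_top_le_ker (k : Type*) {A : Type*} [CommRing k] [CommRing A] [Algebra k A] (f : A)
    (n : ℕ) : (Ideal.span {f} • ⊤ : Submodule A (UnivModule k A n)) ≤
      LinearMap.ker (map (Ideal.Quotient.mkₐ k (Ideal.span {f})) n) := by
  refine Submodule.smul_le.2 fun r hr x _ => ?_
  have hr0 : Ideal.Quotient.mk (Ideal.span {f}) r = 0 := Ideal.Quotient.eq_zero_iff_mem.2 hr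
  rw [LinearMap.mem_ker, LinearMap.map_smulₛₗ]
  change Ideal.Quotient.mk (Ideal.span {f}) r • _ = _
  rw [hr0, zero_smul]

/-- The canonical `A / (f)`-linear map `Ω_n(A) / f Ω_n(A) → Ω_n(A / (f))`. -/
def reductionMap (k : Type*) {A : Type*} [CommRing k] [CommRing A] [Algebra k A] (f : A) (n : ℕ) :
    Reduction k f n →ₗ[A ⧸ Ideal.span {f}] UnivModule k (A ⧸ Ideal.span {f}) n where
  toFun := Submodule.liftQ _ (map (Ideal.Quotient.mkₐ k (Ideal.span {f})) n)
    (smul_top_le_ker k f n)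
  map_add' := map_add _
  map_smul' c x := by
    obtain ⟨a, rfl⟩ := Ideal.Quotient.mk_surjective c
    exact LinearMap.map_smulₛₗ (Submodule.liftQ _ (map (Ideal.Quotient.mkₐ k (Ideal.span {f})) n)
      (smul_top_le_ker k f n)) a x

end

end UnivModule

/-- `0 → F₁ → F₀ → M → 0` (with maps `δ` and `ε`) is a minimal free resolution of `M` over the
local ring `A` (so all further terms are zero): it is exact, `F₁` and `F₀` are free of finite rank,
and `δ(F₁) ⊆ 𝔪 F₀`, where `𝔪` is the maximal ideal of `A`. -/
structure IsMinimalFreeResolution (A : Type*) [CommRing A] [IsLocalRing A] {F₁ F₀ M : Type*}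
    [AddCommGroup F₁] [AddCommGroup F₀] [AddCommGroup M] [Module A F₁] [Module A F₀] [Module A M]
    (δ : F₁ →ₗ[A] F₀) (ε : F₀ →ₗ[A] M) : Prop where
  free₁ : Module.Free A F₁
  finite₁ : Module.Finite A F₁
  free₀ : Module.Free A F₀
  finite₀ : Module.Finite A F₀
  injective : Function.Injective δ
  exact : Function.Exact δ ε
  surjective : Function.Surjective ε
  minimal : LinearMap.range δ ≤ IsLocalRing.maximalIdeal A • (⊤ : Submodule A F₀)

/-! Write S = k[x] and R = S/(f). The substitution a ⊗ b ↦ a(x) b(x+y) identifies S ⊗ S with S[y]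
and I_S with the ideal (y). Hence Ω_n(S) = (y)/(y)^(n+1) is free on the y^β with 1 ≤ |β| ≤ n, and
d_n(g) becomes the truncation of g(x+y) - g(x).

Over R, the polynomial F = f(x+y) has no constant term, and d_n(af) becomes a(x+y)F. The a(x+y),
with a a monomial of degree < n, span the polynomials of degree < n in R[y]. So the relations are
the image of multiplication by F from R[y]/(y)^n to (y)/(y)^(n+1), generated by the d_n(x^α f) with
|α| < n (`relations_eq_span`, `map_relations`).

That multiplication is injective: in characteristic zero some ∂f/∂x_i is not divisible by the
irreducible f, so F has order exactly 1 in y, and orders add over the domain R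
(`mulTaylorCoeffs_polyBelow_injective`). The relations are therefore free of rank #{β : |β| < n}.

Exactness holds because the kernel of S ⊗ S → R ⊗ R is generated by f ⊗ 1 and 1 ⊗ f, which become 0
and F over R (`exact_reductionMap`). The hypothesis on d_n(x^α f) puts the generators of the
relations in 𝔪. All this happens over R, before localizing. -/

namespace MvPolynomial

/-! ### Taylor expansion and the isomorphism S ⊗ S ≅ S[y] -/

section Taylor

variable {k σ A : Type*} [CommRing k] [CommRing A] [Algebra k A]

/-- The Taylor expansion `g ↦ g(x + y)`, as a polynomial in `y` whose coefficients are mapped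
to `A` by `π`. -/
noncomputable def taylor (π : MvPolynomial σ k →ₐ[k] A) : MvPolynomial σ k →ₐ[k] MvPolynomial σ A :=
  aeval fun i => C (π (X i)) + X i

/-- The map `a ⊗ b ↦ a · b(x + y)`. -/
noncomputable def tensorTaylor (π : MvPolynomial σ k →ₐ[k] A) :
    MvPolynomial σ k ⊗[k] MvPolynomial σ k →ₐ[k] MvPolynomial σ A :=
  Algebra.TensorProduct.lift ((IsScalarTower.toAlgHom k A (MvPolynomial σ A)).comp π) (taylor π)
    fun _ _ => Commute.all _ _

variable (π : MvPolynomial σ k →ₐ[k] A)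

@[simp]
theorem taylor_X (i : σ) : taylor π (X i) = C (π (X i)) + X i := by simp [taylor]

@[simp]
theorem tensorTaylor_tmul (a b : MvPolynomial σ k) :
    tensorTaylor π (a ⊗ₜ b) = C (π a) * taylor π b := by
  simp [tensorTaylor, algebraMap_eq]

@[simp]
theorem taylor_C (a : k) : taylor π (C a) = C (algebraMap k A a) := by
  rw [← algebraMap_eq, AlgHom.commutes]
  rfl

theorem constantCoeff_taylor (g : MvPolynomial σ k) : constantCoeff (taylor π g) = π g := by
  induction g using MvPolynomial.induction_on with
  | C a => rw [taylor_C, constantCoeff_C, ← algebraMap_eq, AlgHom.commutes]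
  | add p q hp hq => simp [hp, hq]
  | mul_X p i hp => simp [hp]

theorem coeff_single_one_taylor (g : MvPolynomial σ k) (i : σ) :
    coeff (Finsupp.single i 1) (taylor π g) = π (pderiv i g) := by
  classical
  induction g using MvPolynomial.induction_on with
  | C a =>
    have h : (0 : σ →₀ ℕ) ≠ Finsupp.single i 1 := (Finsupp.single_ne_zero.2 one_ne_zero).symm
    simp [coeff_C, h]
  | add p q hp hq => simp [hp, hq]
  | mul_X p j hp =>
    have h0 : coeff 0 (taylor π p) = π p := constantCoeff_taylor π p
    rw [map_mul, taylor_X, mul_add, coeff_add, mul_comm _ (C _), coeff_C_mul, hp, coeff_mul_X',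
      Derivation.leibniz, pderiv_X]
    by_cases hij : i = j
    · subst hij
      simp [h0, add_comm]
    · have : j ∉ (Finsupp.single i 1).support := by
        simp [Ne.symm hij]
      rw [if_neg this]
      simp [Ne.symm hij]

theorem mem_idealOfVars_iff {p : MvPolynomial σ A} :
    p ∈ idealOfVars σ A ↔ constantCoeff p = 0 := by
  have h := mem_pow_idealOfVars_iff' (σ := σ) (R := A) 1 p
  rw [pow_one] at h
  simp only [h, Nat.lt_one_iff, Finsupp.degree_eq_zero_iff, forall_eq, constantCoeff_eq]

theorem constantCoeff_tensorTaylor (u : MvPolynomial σ k ⊗[k] MvPolynomial σ k) :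
    constantCoeff (tensorTaylor π u) = π (Algebra.TensorProduct.lmul' k u) := by
  induction u with
  | zero => simp
  | add x y hx hy => simp [hx, hy]
  | tmul a b => simp only [tensorTaylor_tmul, map_mul, constantCoeff_taylor]; simp

theorem tensorTaylor_mem_idealOfVars {u : MvPolynomial σ k ⊗[k] MvPolynomial σ k}
    (hu : u ∈ KaehlerDifferential.ideal k (MvPolynomial σ k)) :
    tensorTaylor π u ∈ idealOfVars σ A := by
  have hu' : Algebra.TensorProduct.lmul' k (S := MvPolynomial σ k) u = 0 := hu
  rw [mem_idealOfVars_iff, constantCoeff_tensorTaylor, hu', map_zero]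

theorem tensorTaylor_mem_pow {u : MvPolynomial σ k ⊗[k] MvPolynomial σ k} {n : ℕ}
    (hu : u ∈ KaehlerDifferential.ideal k (MvPolynomial σ k) ^ n) :
    tensorTaylor π u ∈ idealOfVars σ A ^ n := by
  have h1 : (KaehlerDifferential.ideal k (MvPolynomial σ k)).map (tensorTaylor π) ≤
      idealOfVars σ A :=
    Ideal.map_le_iff_le_comap.2 fun y hy => tensorTaylor_mem_idealOfVars π hy
  have h2 := Ideal.mem_map_of_mem (tensorTaylor π) hu
  rw [Ideal.map_pow] at h2
  exact Ideal.pow_right_mono h1 n h2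

theorem map_taylor_id (g : MvPolynomial σ k) :
    map (π : MvPolynomial σ k →+* A) (taylor (AlgHom.id k _) g) = taylor π g := by
  induction g using MvPolynomial.induction_on with
  | C a =>
    rw [taylor_C, taylor_C, map_C, algebraMap_eq, ← AlgHom.commutes π, algebraMap_eq]
    rfl
  | add p q hp hq => simp [hp, hq]
  | mul_X p i hp => simp [hp]

/-- This compares the two expansions in use: over S itself (`π` the identity), where the isomorphism
lives, and over R (`π` the quotient map). -/
theorem map_tensorTaylor_id (u : MvPolynomial σ k ⊗[k] MvPolynomial σ k) :
    map (π : MvPolynomial σ k →+* A) (tensorTaylor (AlgHom.id k _) u) = tensorTaylor π u := by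
  induction u with
  | zero => simp
  | add x y hx hy => simp [hx, hy]
  | tmul a b => simp [map_taylor_id]

variable (k σ)

/-- The inverse `y ↦ 1 ⊗ x - x ⊗ 1` of `a ⊗ b ↦ a · b(x + y)`. -/
noncomputable def tensorTaylorInv :
    MvPolynomial σ (MvPolynomial σ k) →ₐ[MvPolynomial σ k]
      MvPolynomial σ k ⊗[k] MvPolynomial σ k :=
  aeval fun i => (1 : MvPolynomial σ k) ⊗ₜ[k] X i - X i ⊗ₜ[k] (1 : MvPolynomial σ k)

theorem tensorTaylorInv_tensorTaylor (u : MvPolynomial σ k ⊗[k] MvPolynomial σ k) :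
    tensorTaylorInv k σ (tensorTaylor (AlgHom.id k _) u) = u := by
  have h : ((tensorTaylorInv k σ).restrictScalars k).comp (tensorTaylor (AlgHom.id k _)) =
      AlgHom.id k _ := by
    apply Algebra.TensorProduct.ext
    · ext i
      simp [tensorTaylorInv]
    · ext i
      simp [tensorTaylorInv]
  exact DFunLike.congr_fun h u

theorem tensorTaylor_tensorTaylorInv (p : MvPolynomial σ (MvPolynomial σ k)) :
    tensorTaylor (AlgHom.id k _) (tensorTaylorInv k σ p) = p := by
  induction p using MvPolynomial.induction_on with
  | C a =>
    rw [tensorTaylorInv, algHom_C]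
    simp [Algebra.TensorProduct.algebraMap_apply]
  | add p q hp hq => simp [hp, hq]
  | mul_X p j hp => rw [map_mul, map_mul, hp]; simp [tensorTaylorInv]

theorem tensorTaylorInv_mem_pow {p : MvPolynomial σ (MvPolynomial σ k)} {n : ℕ}
    (hp : p ∈ idealOfVars σ (MvPolynomial σ k) ^ n) :
    tensorTaylorInv k σ p ∈ KaehlerDifferential.ideal k (MvPolynomial σ k) ^ n := by
  have h1 : (idealOfVars σ (MvPolynomial σ k)).map (tensorTaylorInv k σ) ≤
      KaehlerDifferential.ideal k (MvPolynomial σ k) := by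
    rw [idealOfVars, Ideal.map_span, Ideal.span_le]
    rintro _ ⟨_, ⟨i, rfl⟩, rfl⟩
    simp [tensorTaylorInv]
  have h2 := Ideal.mem_map_of_mem (tensorTaylorInv k σ) hp
  rw [Ideal.map_pow] at h2
  exact Ideal.pow_right_mono h1 n h2

end Taylor

end MvPolynomial

/-! ### Partial derivatives, orders in y, and spans of Taylor expansions -/

namespace MvPolynomial

theorem totalDegree_pderiv_lt {k σ : Type*} [CommRing k] {f : MvPolynomial σ k} {i : σ}
    (h : pderiv i f ≠ 0) : (pderiv i f).totalDegree < f.totalDegree := by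
  have key : ∀ d ∈ (pderiv i f).support, d.degree + 1 ≤ f.totalDegree := by
    intro d hd
    rw [mem_support_iff, coeff_pderiv] at hd
    have h1 : (d + Finsupp.single i 1).degree ≤ f.totalDegree :=
      le_totalDegree (mem_support_iff.2 (left_ne_zero_of_mul hd))
    simpa using h1
  obtain ⟨d, hd⟩ := support_nonempty.2 h
  exact (Finset.sup_lt_iff (Nat.lt_of_lt_of_le (Nat.succ_pos _) (key d hd))).2 key

theorem exists_pderiv_ne_zero {k σ : Type*} [CommRing k] [IsDomain k] [CharZero k]
    {f : MvPolynomial σ k} (hf : f.totalDegree ≠ 0) : ∃ i, pderiv i f ≠ 0 := by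
  by_contra! h
  refine hf (totalDegree_eq_zero_iff_eq_C.2 (ext _ _ fun d => ?_))
  by_cases hd : d = 0
  · simp [hd]
  · obtain ⟨i, hi⟩ := Finsupp.ne_iff.1 hd
    have h1 : Finsupp.single i 1 ≤ d := by simpa [Nat.one_le_iff_ne_zero] using hi
    have h2 := congrArg (coeff (d - Finsupp.single i 1)) (h i)
    rw [coeff_pderiv, tsub_add_cancel_of_le h1, coeff_zero, mul_eq_zero] at h2
    rw [h2.resolve_right (Nat.cast_add_one_ne_zero _), coeff_C_of_ne_zero hd]

/-- An irreducible polynomial is nonconstant, so some partial derivative is nonzero; having smaller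
degree than f, it cannot be a multiple of f. -/
theorem exists_pderiv_notMem_span {k σ : Type*} [Field k] [CharZero k] {f : MvPolynomial σ k}
    (hf : Irreducible f) : ∃ i, pderiv i f ∉ Ideal.span {f} := by
  have hdeg : f.totalDegree ≠ 0 := by
    intro h
    rw [totalDegree_eq_zero_iff_eq_C] at h
    have hc : coeff 0 f ≠ 0 := by
      rintro h0
      rw [h0, map_zero] at h
      exact hf.ne_zero h
    exact hf.not_isUnit (h ▸ (isUnit_iff_ne_zero.2 hc).map C)
  obtain ⟨i, hi⟩ := exists_pderiv_ne_zero hdeg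
  refine ⟨i, fun hmem => ?_⟩
  have := totalDegree_le_of_dvd_of_isDomain (Ideal.mem_span_singleton.1 hmem) hi
  exact absurd (totalDegree_pderiv_lt hi) (not_lt.2 this)

/-- Over a domain the order of power series is additive. As F has order at most 1, F g of order at
least n + 1 forces g to have order at least n. -/
theorem coeff_eq_zero_of_coeff_mul_eq_zero {σ A : Type*} [CommRing A] [IsDomain A]
    {F g : MvPolynomial σ A} {i : σ} (hF : coeff (Finsupp.single i 1) F ≠ 0) {n : ℕ}
    (h : ∀ β : σ →₀ ℕ, β.degree < n + 1 → coeff β (F * g) = 0) (β : σ →₀ ℕ) (hβ : β.degree < n) :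
    coeff β g = 0 := by
  rw [← coeff_coe]
  refine MvPowerSeries.coeff_of_lt_order ?_
  have h1 : (F : MvPowerSeries σ A).order ≤ 1 := by
    refine (MvPowerSeries.order_le (d := Finsupp.single i 1) (by simpa using hF)).trans ?_
    simp
  have h2 : ((n + 1 : ℕ) : ℕ∞) ≤ ((F * g : MvPolynomial σ A) : MvPowerSeries σ A).order :=
    MvPowerSeries.nat_le_order fun d hd => by rw [coeff_coe]; exact h d hd
  rw [coe_mul, MvPowerSeries.order_mul] at h2
  have h3 := h2.trans (add_le_add_left h1 _)
  push_cast at h3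
  rw [add_comm (n : ℕ∞) 1] at h3
  have h4 := (ENat.add_le_add_iff_left ENat.one_ne_top).1 h3
  exact lt_of_lt_of_le (by exact_mod_cast hβ) h4

theorem totalDegree_aeval_le {σ τ A : Type*} [CommRing A] {q : σ → MvPolynomial τ A}
    (hq : ∀ i, (q i).totalDegree ≤ 1) (p : MvPolynomial σ A) :
    (aeval q p).totalDegree ≤ p.totalDegree := by
  rw [aeval_def, eval₂_eq]
  refine totalDegree_finsetSum_le fun d hd => ?_
  refine (totalDegree_mul _ _).trans ?_
  rw [algebraMap_eq, totalDegree_C, zero_add]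
  refine ((totalDegree_finsetProd _ _).trans (Finset.sum_le_sum fun i _ => ?_)).trans
    (le_totalDegree hd)
  exact (totalDegree_pow _ _).trans (by simpa using Nat.mul_le_mul_left (d i) (hq i))

variable {k σ A : Type*} [CommRing k] [CommRing A] [Algebra k A]

/-- Translating y by -π(x) and back writes g as a combination of the (π(x) + y)^α; the translation
is affine, so it does not raise the degree. -/
theorem mem_span_taylor_monomial (π : MvPolynomial σ k →ₐ[k] A) {n : ℕ} {g : MvPolynomial σ A}
    (hg : ∀ β, n ≤ β.degree → coeff β g = 0) :
    g ∈ Submodule.span A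
      ((fun α : σ →₀ ℕ => taylor π (monomial α 1)) '' {α | α.degree < n}) := by
  classical
  by_cases hg0 : g = 0
  · rw [hg0]
    exact zero_mem _
  have hgn : g.totalDegree < n := by
    have hn : 0 < n := by
      by_contra hn
      exact hg0 (ext _ _ fun β => hg β (by omega))
    refine (Finset.sup_lt_iff hn).2 fun β hβ => ?_
    by_contra h
    exact mem_support_iff.1 hβ (hg β (not_lt.1 h))
  set h : MvPolynomial σ A := aeval (fun i => X i - C (π (X i))) g with hh
  have hdeg : h.totalDegree < n := by
    refine lt_of_le_of_lt (totalDegree_aeval_le (fun i => ?_) g) hgn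
    refine (totalDegree_sub_C_le _ _).trans ?_
    exact (totalDegree_monomial_le _ _).trans (by simp)
  have hback : aeval (fun i => C (π (X i)) + X i) h = g := by
    rw [hh, ← AlgHom.comp_apply]
    conv_rhs => rw [← AlgHom.id_apply (R := A) g]
    congr 1
    ext i
    simp
  rw [← hback, aeval_def, eval₂_eq]
  refine Submodule.sum_mem _ fun α hα => ?_
  rw [algebraMap_eq, ← smul_eq_C_mul]
  refine Submodule.smul_mem _ _ (Submodule.subset_span ⟨α, ?_, ?_⟩)
  · exact (le_totalDegree hα).trans_lt hdeg
  · simp only [taylor, aeval_monomial, map_one, one_mul]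
    rfl

end MvPolynomial

/-! ### Counting exponents -/

/-- The exponents of total degree less than `n`. -/
def exponentsBelow (σ : Type*) [Fintype σ] [DecidableEq σ] (n : ℕ) : Finset (σ →₀ ℕ) :=
  (Finset.range n).biUnion fun j => Finset.univ.finsuppAntidiag j

theorem mem_exponentsBelow {σ : Type*} [Fintype σ] [DecidableEq σ] {n : ℕ} {β : σ →₀ ℕ} :
    β ∈ exponentsBelow σ n ↔ β.degree < n := by
  simp [exponentsBelow, Finset.mem_finsuppAntidiag, Finsupp.degree_eq_sum]

theorem card_exponentsBelow {s : ℕ} (hs : s ≠ 0) (n : ℕ) :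
    (exponentsBelow (Fin s) n).card = (n + s - 1).choose s := by
  obtain ⟨s, rfl⟩ := Nat.exists_eq_succ_of_ne_zero hs
  have hdisj : ((Finset.range n : Finset ℕ) : Set ℕ).PairwiseDisjoint
      fun j => (Finset.univ : Finset (Fin (s + 1))).finsuppAntidiag j := by
    intro i _ j _ hij
    refine Finset.disjoint_left.2 fun β hi hj => hij ?_
    rw [Finset.mem_finsuppAntidiag] at hi hj
    exact hi.1.symm.trans hj.1
  rw [exponentsBelow, Finset.card_biUnion hdisj]
  simp only [Finset.card_finsuppAntidiag_nat_eq_choose, Finset.card_univ, Fintype.card_fin]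
  -- What remains is the hockey-stick identity, by Pascal's rule. For s = n = 0 the formula would
  -- fail: truncated subtraction gives 1 where the count is 0.
  clear hdisj
  induction n with
  | zero => simp
  | succ n ih =>
    rw [Finset.sum_range_succ, ih, show n + 1 + (s + 1) - 1 = (n + s) + 1 by omega,
      Nat.choose_succ_succ, show n + (s + 1) - 1 = n + s by omega,
      show s + 1 + n - 1 = n + s by omega, Nat.choose_symm_add, Nat.succ_eq_add_one]
    omega

theorem card_exponentsBelow_erase_zero (s n : ℕ) :
    ((exponentsBelow (Fin s) (n + 1)).erase 0).card = (n + s).choose s - 1 := by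
  rw [Finset.card_erase_of_mem (mem_exponentsBelow.2 (by simp))]
  rcases eq_or_ne s 0 with rfl | hs
  · have : (exponentsBelow (Fin 0) (n + 1)).card ≤ 1 := Finset.card_le_one_of_subsingleton _
    simpa [Nat.sub_eq_zero_iff_le] using this
  · rw [card_exponentsBelow hs, show n + 1 + s - 1 = n + s by omega]

/-! ### Coordinates on Ω_n(S) and on Ω_n(S)/f Ω_n(S) -/

namespace UnivModule

open MvPolynomial

variable {k σ A : Type*} [Field k] [CommRing A] [Algebra k A] [Fintype σ] [DecidableEq σ]

theorem mk_surjective (k A : Type*) [CommRing k] [CommRing A] [Algebra k A] (n : ℕ) :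
    Function.Surjective (mk k A n) := by
  rintro ⟨u⟩
  exact ⟨u, rfl⟩

theorem mk_eq_zero_iff {k A : Type*} [CommRing k] [CommRing A] [Algebra k A] {n : ℕ}
    {u : KaehlerDifferential.ideal k A} :
    mk k A n u = 0 ↔ (u : A ⊗[k] A) ∈ KaehlerDifferential.ideal k A ^ (n + 1) :=
  Submodule.Quotient.mk_eq_zero _

/-- The Taylor coefficients of degree `1, …, n` of an element of `Ω_n(k[x])`, mapped to `A`. -/
noncomputable def coeffs (π : MvPolynomial σ k →ₐ[k] A) (n : ℕ) :
    UnivModule k (MvPolynomial σ k) n →ₛₗ[(π : MvPolynomial σ k →+* A)]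
      ((exponentsBelow σ (n + 1)).erase 0 → A) where
  -- The quotient is by an S ⊗ S-submodule, but taking coefficients respects only the left factor,
  -- so the map descends additively and semilinearity is checked afterwards.
  toFun := QuotientAddGroup.lift
    (Submodule.submoduleOf (KaehlerDifferential.ideal k (MvPolynomial σ k) ^ (n + 1))
      (KaehlerDifferential.ideal k (MvPolynomial σ k))).toAddSubgroup
    { toFun u β := coeff β.1 (tensorTaylor π u.1)
      map_zero' := by ext; simp
      map_add' _ _ := by ext; simp }
    fun u hu => by
      have h : u.1 ∈ KaehlerDifferential.ideal k (MvPolynomial σ k) ^ (n + 1) := hu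
      ext β
      exact (mem_pow_idealOfVars_iff' _ _).1 (tensorTaylor_mem_pow π h) β.1
        (mem_exponentsBelow.1 (Finset.mem_of_mem_erase β.2))
  map_add' := map_add _
  map_smul' a x := by
    obtain ⟨u, rfl⟩ := mk_surjective _ _ _ x
    ext β
    change coeff β.1 (tensorTaylor π (a • u.1)) = π a * coeff β.1 (tensorTaylor π u.1)
    rw [Algebra.smul_def, map_mul, Algebra.TensorProduct.algebraMap_apply, tensorTaylor_tmul]
    simp

@[simp]
theorem coeffs_mk (π : MvPolynomial σ k →ₐ[k] A) (n : ℕ)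
    (u : KaehlerDifferential.ideal k (MvPolynomial σ k))
    (β : (exponentsBelow σ (n + 1)).erase 0) :
    coeffs π n (mk k _ n u) β = coeff β.1 (tensorTaylor π u.1) :=
  rfl

theorem coeffs_d (π : MvPolynomial σ k →ₐ[k] A) (n : ℕ) (g : MvPolynomial σ k)
    (β : (exponentsBelow σ (n + 1)).erase 0) :
    coeffs π n (d k n g) β = coeff β.1 (taylor π g) := by
  rw [d, coeffs_mk, map_sub, tensorTaylor_tmul, tensorTaylor_tmul]
  simp [coeff_C_of_ne_zero (Finset.ne_of_mem_erase β.2)]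

theorem coeffs_eq_comp (π : MvPolynomial σ k →ₐ[k] A) (n : ℕ)
    (x : UnivModule k (MvPolynomial σ k) n) (β : (exponentsBelow σ (n + 1)).erase 0) :
    coeffs π n x β = π (coeffs (AlgHom.id k _) n x β) := by
  obtain ⟨u, rfl⟩ := mk_surjective _ _ _ x
  rw [coeffs_mk, coeffs_mk, ← map_tensorTaylor_id, coeff_map]
  rfl

/-- The constant coefficient already vanishes on I. If those of degree 1, …, n vanish too, the
expansion lies in (y)^(n+1), which the inverse isomorphism sends into I^(n+1). -/
theorem coeffs_id_injective (n : ℕ) :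
    Function.Injective (coeffs (AlgHom.id k (MvPolynomial σ k)) n) := by
  refine (injective_iff_map_eq_zero _).2 fun x hx => ?_
  obtain ⟨u, rfl⟩ := mk_surjective _ _ _ x
  rw [mk_eq_zero_iff, ← tensorTaylorInv_tensorTaylor k σ u.1]
  refine tensorTaylorInv_mem_pow k σ ((mem_pow_idealOfVars_iff' _ _).2 fun β hβ => ?_)
  rcases eq_or_ne β 0 with rfl | hβ0
  · exact mem_idealOfVars_iff.1 (tensorTaylor_mem_idealOfVars _ u.2)
  · exact congrFun hx ⟨β, Finset.mem_erase.2 ⟨hβ0, mem_exponentsBelow.2 hβ⟩⟩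

theorem coeffs_id_surjective (n : ℕ) :
    Function.Surjective (coeffs (AlgHom.id k (MvPolynomial σ k)) n) := by
  intro c
  set p : MvPolynomial σ (MvPolynomial σ k) := ∑ β, monomial β.1 (c β) with hp
  have hcoeff : ∀ β : (exponentsBelow σ (n + 1)).erase 0, coeff β.1 p = c β := by
    intro β
    simp [hp, coeff_sum, coeff_monomial]
  have hp1 : p ∈ idealOfVars σ (MvPolynomial σ k) ^ 1 := by
    rw [pow_one, mem_idealOfVars_iff, hp, map_sum]
    exact Finset.sum_eq_zero fun β _ => by
      rw [constantCoeff_monomial, if_neg (Finset.ne_of_mem_erase β.2)]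
  refine ⟨mk k _ n ⟨tensorTaylorInv k σ p, by simpa using tensorTaylorInv_mem_pow k σ hp1⟩, ?_⟩
  ext1 β
  rw [coeffs_mk, tensorTaylor_tensorTaylorInv, hcoeff]

variable (f : MvPolynomial σ k) (n : ℕ)

/-- The coordinates of `Ω_n(k[x]) / f Ω_n(k[x])` with respect to the basis `y ^ β`,
`1 ≤ |β| ≤ n`. -/
noncomputable def reductionCoeffs : Reduction k f n →ₗ[MvPolynomial σ k ⧸ Ideal.span {f}]
    ((exponentsBelow σ (n + 1)).erase 0 → MvPolynomial σ k ⧸ Ideal.span {f}) where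
  toFun := Submodule.liftQ _ (coeffs (Ideal.Quotient.mkₐ k (Ideal.span {f})) n) <| by
    refine Submodule.smul_le.2 fun r hr x _ => ?_
    have hr0 : Ideal.Quotient.mk (Ideal.span {f}) r = 0 := Ideal.Quotient.eq_zero_iff_mem.2 hr
    rw [LinearMap.mem_ker, LinearMap.map_smulₛₗ]
    ext1 β
    change Ideal.Quotient.mk (Ideal.span {f}) r * _ = 0
    rw [hr0, zero_mul]
  map_add' := map_add _
  map_smul' c x := by
    obtain ⟨a, rfl⟩ := Ideal.Quotient.mk_surjective c
    obtain ⟨x, rfl⟩ := Submodule.mkQ_surjective _ x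
    exact LinearMap.map_smulₛₗ (coeffs (Ideal.Quotient.mkₐ k (Ideal.span {f})) n) a x

theorem reductionCoeffs_mkQ (x : UnivModule k (MvPolynomial σ k) n) :
    reductionCoeffs f n (Submodule.mkQ _ x) =
      coeffs (Ideal.Quotient.mkₐ k (Ideal.span {f})) n x :=
  rfl

theorem reductionCoeffs_bijective : Function.Bijective (reductionCoeffs f n) := by
  constructor
  · refine (injective_iff_map_eq_zero _).2 fun x hx => ?_
    obtain ⟨x, rfl⟩ := Submodule.mkQ_surjective _ x
    rw [reductionCoeffs_mkQ] at hx
    -- Coordinates vanishing in R are multiples of f in S; the cofactors are the coordinates of some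
    -- y, and x = f y.
    have h1 : ∀ β, ∃ a, coeffs (AlgHom.id k (MvPolynomial σ k)) n x β = f * a := by
      intro β
      have h2 := congrFun hx β
      rw [coeffs_eq_comp] at h2
      exact Ideal.mem_span_singleton.1 (Ideal.Quotient.eq_zero_iff_mem.1 h2)
    choose a ha using h1
    obtain ⟨y, hy⟩ := coeffs_id_surjective n a
    have hxy : x = f • y := by
      apply coeffs_id_injective n
      rw [LinearMap.map_smulₛₗ, hy]
      ext1 β
      exact ha β
    rw [hxy, Submodule.mkQ_apply, Submodule.Quotient.mk_eq_zero]
    exact Submodule.smul_mem_smul (Ideal.mem_span_singleton_self f) trivial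
  · intro c
    choose b hb using fun β => Ideal.Quotient.mk_surjective (c β)
    obtain ⟨y, hy⟩ := coeffs_id_surjective n b
    refine ⟨Submodule.mkQ _ y, ?_⟩
    ext1 β
    rw [reductionCoeffs_mkQ, coeffs_eq_comp, hy]
    exact hb β

/-- `Ω_n(k[x]) / f Ω_n(k[x])` is free over `k[x] / (f)` with basis `y ^ β`, `1 ≤ |β| ≤ n`. -/
noncomputable def reductionEquiv : Reduction k f n ≃ₗ[MvPolynomial σ k ⧸ Ideal.span {f}]
    ((exponentsBelow σ (n + 1)).erase 0 → MvPolynomial σ k ⧸ Ideal.span {f}) :=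
  LinearEquiv.ofBijective (reductionCoeffs f n) (reductionCoeffs_bijective f n)

end UnivModule
-- The module of relations, and exactness
namespace UnivModule

open MvPolynomial

section Relations

variable {k A : Type*} [CommRing k] [CommRing A] [Algebra k A] (f : A) (n : ℕ)

theorem mkQ_d_mem_relations {g : A} (hg : g ∈ Ideal.span {f}) :
    (Submodule.mkQ _ (d k n g) : Reduction k f n) ∈ relations k f n :=
  Submodule.mem_map_of_mem (Submodule.mem_sup_left (Submodule.subset_span ⟨g, hg, rfl⟩))

theorem relations_le {P : Submodule (A ⧸ Ideal.span {f}) (Reduction k f n)}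
    (hP : ∀ a, (Submodule.mkQ _ (d k n (a * f)) : Reduction k f n) ∈ P) :
    relations k f n ≤ P := by
  rintro _ ⟨w, hw, rfl⟩
  obtain ⟨y, hy, z, hz, rfl⟩ := Submodule.mem_sup.1 hw
  have hz0 : (Submodule.mkQ _ z : Reduction k f n) = 0 := (Submodule.Quotient.mk_eq_zero _).2 hz
  change (Submodule.mkQ _ (y + z) : Reduction k f n) ∈ P
  rw [map_add, hz0, add_zero]
  clear hz hz0 hw
  rw [N] at hy
  induction hy using Submodule.span_induction with
  | mem x hx =>
    obtain ⟨g, hg, rfl⟩ := hx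
    obtain ⟨a, rfl⟩ := Ideal.mem_span_singleton'.1 hg
    exact hP a
  | zero =>
    rw [map_zero]
    exact zero_mem _
  | add x y _ _ hx hy =>
    rw [map_add]
    exact add_mem hx hy
  | smul a x _ hx => exact P.smul_mem (Ideal.Quotient.mk _ a) hx

theorem map_mk {B : Type*} [CommRing B] [Algebra k B] (φ : A →ₐ[k] B)
    (u : KaehlerDifferential.ideal k A) : map φ n (mk k A n u) = mk k B n (idealMap φ u) :=
  rfl

theorem map_d {B : Type*} [CommRing B] [Algebra k B] (φ : A →ₐ[k] B) (a : A) :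
    map φ n (d k n a) = d k n (φ a) := by
  rw [d, map_mk, d]
  congr 1
  ext
  simp [idealMap]

theorem d_zero : d k n (0 : A) = 0 := by
  rw [d, mk_eq_zero_iff]
  simp

theorem reductionMap_mkQ (x : UnivModule k A n) :
    reductionMap k f n (Submodule.mkQ _ x) = map (Ideal.Quotient.mkₐ k (Ideal.span {f})) n x :=
  rfl

theorem relations_le_ker : relations k f n ≤ LinearMap.ker (reductionMap k f n) := by
  refine relations_le f n fun a => ?_
  have h : Ideal.Quotient.mkₐ k (Ideal.span {f}) (a * f) = 0 :=
    Ideal.Quotient.eq_zero_iff_mem.2 (Ideal.mul_mem_left _ _ (Ideal.mem_span_singleton_self f))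
  rw [LinearMap.mem_ker, reductionMap_mkQ, map_d, h, d_zero]

theorem map_ideal_of_surjective {B : Type*} [CommRing B] [Algebra k B] {φ : A →ₐ[k] B}
    (hφ : Function.Surjective φ) :
    (KaehlerDifferential.ideal k A).map (Algebra.TensorProduct.map φ φ) =
      KaehlerDifferential.ideal k B := by
  refine le_antisymm (Ideal.map_le_iff_le_comap.2 fun y hy => map_mem_ideal φ hy) ?_
  rw [← KaehlerDifferential.span_range_eq_ideal, Ideal.span_le]
  rintro _ ⟨b, rfl⟩
  obtain ⟨a, rfl⟩ := hφ b
  have h := Ideal.mem_map_of_mem (Algebra.TensorProduct.map φ φ)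
    (KaehlerDifferential.one_smul_sub_smul_one_mem_ideal k a)
  simpa using h

theorem map_surjective_of_surjective {B : Type*} [CommRing B] [Algebra k B] {φ : A →ₐ[k] B}
    (hφ : Function.Surjective φ) : Function.Surjective (map φ n) := by
  intro y
  obtain ⟨⟨v, hv⟩, rfl⟩ := mk_surjective _ _ _ y
  have hs : Function.Surjective (Algebra.TensorProduct.map φ φ) :=
    TensorProduct.map_surjective hφ hφ
  rw [← map_ideal_of_surjective hφ] at hv
  obtain ⟨u, hu, rfl⟩ := (Ideal.mem_map_iff_of_surjective _ hs).1 hv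
  exact ⟨mk k A n ⟨u, hu⟩, rfl⟩

theorem reductionMap_surjective : Function.Surjective (reductionMap k f n) := by
  intro y
  obtain ⟨x, rfl⟩ := map_surjective_of_surjective n
    (Ideal.Quotient.mkₐ_surjective k (Ideal.span {f})) y
  exact ⟨Submodule.mkQ _ x, rfl⟩

end Relations

variable {k σ : Type*} [Field k] (f : MvPolynomial σ k) (n : ℕ)

/-- The Taylor expansion `f(x + y)` with coefficients in `k[x] / (f)`. -/
noncomputable abbrev taylorMod : MvPolynomial σ (MvPolynomial σ k ⧸ Ideal.span {f}) :=
  taylor (Ideal.Quotient.mkₐ k (Ideal.span {f})) f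

theorem taylorMod_mem : taylorMod f ∈ idealOfVars σ (MvPolynomial σ k ⧸ Ideal.span {f}) := by
  rw [mem_idealOfVars_iff, constantCoeff_taylor]
  exact Ideal.Quotient.eq_zero_iff_mem.2 (Ideal.mem_span_singleton_self f)

variable [Fintype σ] [DecidableEq σ]

/-- The coefficients of degree `1, …, n` of `f(x + y) g`. -/
noncomputable def mulTaylorCoeffs :
    MvPolynomial σ (MvPolynomial σ k ⧸ Ideal.span {f}) →ₗ[MvPolynomial σ k ⧸ Ideal.span {f}]
      ((exponentsBelow σ (n + 1)).erase 0 → MvPolynomial σ k ⧸ Ideal.span {f}) where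
  toFun g β := coeff β.1 (taylorMod f * g)
  map_add' _ _ := by ext; simp [mul_add]
  map_smul' _ _ := by ext; simp [mul_smul_comm]

theorem mulTaylorCoeffs_taylor (a : MvPolynomial σ k) :
    mulTaylorCoeffs f n (taylor (Ideal.Quotient.mkₐ k (Ideal.span {f})) a) =
      reductionCoeffs f n (Submodule.mkQ _ (d k n (a * f))) := by
  ext1 β
  rw [reductionCoeffs_mkQ, coeffs_d, mul_comm a, map_mul]
  rfl

/-- The polynomial with prescribed coefficients in degrees less than `n`. -/
noncomputable def polyBelow (σ A : Type*) [Fintype σ] [DecidableEq σ] [CommRing A] (n : ℕ) :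
    (exponentsBelow σ n → A) →ₗ[A] MvPolynomial σ A :=
  ∑ β, (monomial β.1).comp (LinearMap.proj β)

theorem polyBelow_apply {A : Type*} [CommRing A] (c : exponentsBelow σ n → A) :
    polyBelow σ A n c = ∑ β, monomial β.1 (c β) := by
  simp [polyBelow]

theorem coeff_polyBelow {A : Type*} [CommRing A] (c : exponentsBelow σ n → A)
    (β : exponentsBelow σ n) : coeff β.1 (polyBelow σ A n c) = c β := by
  simp [polyBelow_apply, coeff_sum, coeff_monomial]

theorem coeff_polyBelow_of_le {A : Type*} [CommRing A] (c : exponentsBelow σ n → A)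
    {β : σ →₀ ℕ} (hβ : n ≤ β.degree) : coeff β (polyBelow σ A n c) = 0 := by
  rw [polyBelow_apply, coeff_sum]
  refine Finset.sum_eq_zero fun γ _ => ?_
  rw [coeff_monomial, if_neg]
  rintro rfl
  exact absurd (mem_exponentsBelow.1 γ.2) (not_lt.2 hβ)

/-- F has no constant term, so the part of g in degrees ≥ n only affects F g in degrees > n. -/
theorem mulTaylorCoeffs_polyBelow (g : MvPolynomial σ (MvPolynomial σ k ⧸ Ideal.span {f})) :
    mulTaylorCoeffs f n (polyBelow σ _ n fun β => coeff β.1 g) = mulTaylorCoeffs f n g := by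
  rw [← sub_eq_zero, ← map_sub]
  have h1 : (polyBelow σ _ n fun β => coeff β.1 g) - g ∈ idealOfVars σ _ ^ n := by
    refine (mem_pow_idealOfVars_iff' _ _).2 fun β hβ => ?_
    rw [coeff_sub, coeff_polyBelow n _ ⟨β, mem_exponentsBelow.2 hβ⟩, sub_self]
  have h2 := Ideal.mul_mem_mul (taylorMod_mem f) h1
  rw [← pow_succ'] at h2
  ext1 β
  exact (mem_pow_idealOfVars_iff' _ _).1 h2 β.1
    (mem_exponentsBelow.1 (Finset.mem_of_mem_erase β.2))

theorem mulTaylorCoeffs_mem (g : MvPolynomial σ (MvPolynomial σ k ⧸ Ideal.span {f})) :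
    mulTaylorCoeffs f n g ∈ (Submodule.span (MvPolynomial σ k ⧸ Ideal.span {f})
      ((fun α : σ →₀ ℕ => (Submodule.mkQ _ (d k n (monomial α 1 * f)) : Reduction k f n)) ''
        {α | α.degree < n})).map (reductionCoeffs f n) := by
  rw [← mulTaylorCoeffs_polyBelow]
  have h1 := Submodule.mem_map_of_mem (f := mulTaylorCoeffs f n) <|
    mem_span_taylor_monomial (Ideal.Quotient.mkₐ k (Ideal.span {f})) (n := n)
      fun β hβ => coeff_polyBelow_of_le n (fun β : exponentsBelow σ n => coeff β.1 g) hβ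
  rw [Submodule.map_span, Set.image_image] at h1 ⊢
  simpa only [mulTaylorCoeffs_taylor] using h1

/-- The relations are generated by the `d_n(x ^ α f)` with `|α| < n`. -/
theorem relations_eq_span : relations k f n = Submodule.span (MvPolynomial σ k ⧸ Ideal.span {f})
      ((fun α : σ →₀ ℕ => (Submodule.mkQ _ (d k n (monomial α 1 * f)) : Reduction k f n)) ''
        {α | α.degree < n}) := by
  refine le_antisymm (relations_le f n fun a => ?_) (Submodule.span_le.2 ?_)
  · obtain ⟨x, hx, hxa⟩ := mulTaylorCoeffs_mem f n (taylor (Ideal.Quotient.mkₐ k (Ideal.span {f})) a)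
    rw [mulTaylorCoeffs_taylor] at hxa
    rwa [← (reductionCoeffs_bijective f n).1 hxa]
  · rintro _ ⟨α, _, rfl⟩
    exact mkQ_d_mem_relations f n (Ideal.mul_mem_left _ _ (Ideal.mem_span_singleton_self f))

theorem map_relations :
    (relations k f n).map (reductionCoeffs f n) = LinearMap.range (mulTaylorCoeffs f n) := by
  apply le_antisymm
  · rw [Submodule.map_le_iff_le_comap]
    refine relations_le f n fun a => ?_
    rw [Submodule.mem_comap, ← mulTaylorCoeffs_taylor]
    exact LinearMap.mem_range_self _ _
  · rintro _ ⟨g, rfl⟩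
    rw [relations_eq_span]
    exact mulTaylorCoeffs_mem f n g

theorem mulTaylorCoeffs_polyBelow_injective (hf : Irreducible f) [CharZero k] :
    Function.Injective ((mulTaylorCoeffs f n).comp (polyBelow σ _ n)) := by
  obtain ⟨i, hi⟩ := exists_pderiv_notMem_span hf
  have : (Ideal.span {f}).IsPrime := (Ideal.span_singleton_prime hf.ne_zero).2 hf.prime
  have hF : coeff (Finsupp.single i 1) (taylorMod f) ≠ 0 := by
    rw [coeff_single_one_taylor]
    exact fun h => hi (Ideal.Quotient.eq_zero_iff_mem.1 h)
  refine (injective_iff_map_eq_zero _).2 fun c hc => ?_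
  -- `hc` says nothing about the exponent 0, where the coefficient vanishes because F has no
  -- constant term.
  have h : ∀ β : σ →₀ ℕ, β.degree < n + 1 → coeff β (taylorMod f * polyBelow σ _ n c) = 0 := by
    intro β hβ
    rcases eq_or_ne β 0 with rfl | hβ0
    · exact mem_idealOfVars_iff.1 (Ideal.mul_mem_right _ _ (taylorMod_mem f))
    · exact congrFun hc ⟨β, Finset.mem_erase.2 ⟨hβ0, mem_exponentsBelow.2 hβ⟩⟩
  ext1 β
  rw [← coeff_polyBelow n c β]
  exact coeff_eq_zero_of_coeff_mul_eq_zero hF h β.1 (mem_exponentsBelow.1 β.2)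

theorem range_mulTaylorCoeffs_polyBelow :
    LinearMap.range ((mulTaylorCoeffs f n).comp (polyBelow σ _ n)) =
      LinearMap.range (mulTaylorCoeffs f n) := by
  refine le_antisymm (LinearMap.range_comp_le_range _ _) ?_
  rintro _ ⟨g, rfl⟩
  exact ⟨_, mulTaylorCoeffs_polyBelow f n g⟩

/-- The relations form a free module of rank `#{β : |β| < n}`. -/
noncomputable def relationsEquiv (hf : Irreducible f) [CharZero k] :
    relations k f n ≃ₗ[MvPolynomial σ k ⧸ Ideal.span {f}]
      (exponentsBelow σ n → MvPolynomial σ k ⧸ Ideal.span {f}) :=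
  (Submodule.equivMapOfInjective _ (reductionCoeffs_bijective f n).1 _) ≪≫ₗ
    LinearEquiv.ofEq _ _ ((map_relations f n).trans (range_mulTaylorCoeffs_polyBelow f n).symm) ≪≫ₗ
    (LinearEquiv.ofInjective _ (mulTaylorCoeffs_polyBelow_injective f n hf)).symm

theorem exact_reductionMap :
    Function.Exact (relations k f n).subtype (reductionMap k f n) := by
  rw [LinearMap.exact_iff, Submodule.range_subtype]
  refine le_antisymm (fun x hx => ?_) (relations_le_ker f n)
  obtain ⟨x, rfl⟩ := Submodule.mkQ_surjective _ x
  obtain ⟨u, rfl⟩ := mk_surjective _ _ _ x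
  set π := Ideal.Quotient.mkₐ k (Ideal.span {f})
  have hs : Function.Surjective π := Ideal.Quotient.mkₐ_surjective k _
  rw [LinearMap.mem_ker, reductionMap_mkQ, map_mk, mk_eq_zero_iff] at hx
  change Algebra.TensorProduct.map π π u.1 ∈ _ at hx
  -- I_R^(n+1) is the image of I_S^(n+1), so u agrees with some v in I_S^(n+1) modulo the kernel of
  -- S ⊗ S → R ⊗ R.
  rw [← map_ideal_of_surjective hs, ← Ideal.map_pow] at hx
  obtain ⟨v, hv, hvu⟩ :=
    (Ideal.mem_map_iff_of_surjective _ (Algebra.TensorProduct.map_surjective π π hs hs)).1 hx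
  have hker : u.1 - v ∈ RingHom.ker (Algebra.TensorProduct.map π π) := by
    rw [RingHom.mem_ker, map_sub, hvu, sub_self]
  rw [Algebra.TensorProduct.map_ker _ _ hs hs] at hker
  have hle : (RingHom.ker π).map (Algebra.TensorProduct.includeLeft :
        MvPolynomial σ k →ₐ[k] MvPolynomial σ k ⊗[k] MvPolynomial σ k) ⊔
      (RingHom.ker π).map (Algebra.TensorProduct.includeRight :
        MvPolynomial σ k →ₐ[k] MvPolynomial σ k ⊗[k] MvPolynomial σ k) ≤
      (Ideal.span {taylorMod f}).comap (tensorTaylor π) := by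
    refine sup_le (Ideal.map_le_iff_le_comap.2 fun a ha => ?_)
      (Ideal.map_le_iff_le_comap.2 fun a ha => ?_)
    · have ha' : π a = 0 := ha
      simp [ha']
    · obtain ⟨b, rfl⟩ := Ideal.mem_span_singleton.1 (Ideal.Quotient.eq_zero_iff_mem.1 ha)
      simpa using Ideal.mul_mem_right _ _ (Ideal.mem_span_singleton_self (taylorMod f))
  obtain ⟨g, hg⟩ := Ideal.mem_span_singleton.1 (hle hker)
  rw [map_sub, sub_eq_iff_eq_add] at hg
  -- The expansion of u over R is F g plus that of v, and the latter has no terms of degree ≤ n.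
  have hcoeffs : reductionCoeffs f n (Submodule.mkQ _ (mk k _ n u)) = mulTaylorCoeffs f n g := by
    ext1 β
    have h0 := (mem_pow_idealOfVars_iff' _ _).1 (tensorTaylor_mem_pow π hv) β.1
      (mem_exponentsBelow.1 (Finset.mem_of_mem_erase β.2))
    rw [reductionCoeffs_mkQ, coeffs_mk, hg, coeff_add, h0, add_zero]
    rfl
  have hmem : mulTaylorCoeffs f n g ∈ (relations k f n).map (reductionCoeffs f n) := by
    rw [map_relations]
    exact LinearMap.mem_range_self _ _
  obtain ⟨y, hy, hyx⟩ := hmem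
  rwa [← (reductionCoeffs_bijective f n).1 (hyx.trans hcoeffs.symm)]

end UnivModule

/-! ### Localization, minimality and the main theorem -/

/-- A length-one free resolution that is minimal modulo a prime ideal localizes to a minimal free
resolution. -/
theorem isMinimalFreeResolution_localizedModule {R F₁ F₀ M : Type*} [CommRing R]
    [AddCommGroup F₁] [AddCommGroup F₀] [AddCommGroup M] [Module R F₁] [Module R F₀] [Module R M]
    [Module.Free R F₁] [Module.Finite R F₁] [Module.Free R F₀] [Module.Finite R F₀]
    (P : Ideal R) [P.IsPrime] {δ : F₁ →ₗ[R] F₀} {ε : F₀ →ₗ[R] M} (hδ : Function.Injective δ)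
    (hex : Function.Exact δ ε) (hε : Function.Surjective ε)
    (hmin : LinearMap.range δ ≤ P • (⊤ : Submodule R F₀)) :
    IsMinimalFreeResolution (Localization.AtPrime P) (LocalizedModule.map P.primeCompl δ)
      (LocalizedModule.map P.primeCompl ε) where
  free₁ := Module.free_of_isLocalizedModule P.primeCompl (LocalizedModule.mkLinearMap P.primeCompl F₁)
  finite₁ := Module.Finite.of_isLocalizedModule P.primeCompl
    (LocalizedModule.mkLinearMap P.primeCompl F₁)
  free₀ := Module.free_of_isLocalizedModule P.primeCompl (LocalizedModule.mkLinearMap P.primeCompl F₀)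
  finite₀ := Module.Finite.of_isLocalizedModule P.primeCompl
    (LocalizedModule.mkLinearMap P.primeCompl F₀)
  injective := LocalizedModule.map_injective _ _ hδ
  exact := LocalizedModule.map_exact _ _ _ hex
  surjective := LocalizedModule.map_surjective _ _ hε
  minimal := by
    have key : ∀ x ∈ P • (⊤ : Submodule R F₀), LocalizedModule.mk x (1 : P.primeCompl) ∈
        IsLocalRing.maximalIdeal (Localization.AtPrime P) •
          (⊤ : Submodule (Localization.AtPrime P) (LocalizedModule P.primeCompl F₀)) := by
      intro x hx
      refine Submodule.smul_induction_on hx (fun r hr y _ => ?_) fun x y hx hy => ?_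
      · have h : LocalizedModule.mk (r • y) (1 : P.primeCompl) =
            algebraMap R (Localization.AtPrime P) r • LocalizedModule.mk y (1 : P.primeCompl) := by
          rw [algebraMap_smul, LocalizedModule.smul'_mk]
        rw [h]
        exact Submodule.smul_mem_smul
          ((IsLocalization.AtPrime.to_map_mem_maximal_iff (Localization.AtPrime P) P r).2 hr)
          trivial
      · have h : LocalizedModule.mk (x + y) (1 : P.primeCompl) =
            LocalizedModule.mk x 1 + LocalizedModule.mk y 1 :=
          map_add (LocalizedModule.mkLinearMap P.primeCompl F₀) x y
        rw [h]
        exact add_mem hx hy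
    rintro _ ⟨z, rfl⟩
    induction z with
    | h x t =>
      have h : LocalizedModule.map P.primeCompl δ (LocalizedModule.mk x t) =
          Localization.mk 1 t • LocalizedModule.mk (δ x) (1 : P.primeCompl) := by
        rw [LocalizedModule.map_mk, LocalizedModule.mk_smul_mk, one_smul, mul_one]
      rw [h]
      exact Submodule.smul_mem _ _ (key _ (hmin ⟨x, rfl⟩))

theorem UnivModule.relations_le_smul_top {k σ : Type*} [Field k] [Fintype σ] [DecidableEq σ]
    {f : MvPolynomial σ k} {n : ℕ} {m : Ideal (MvPolynomial σ k)}
    (hd : ∀ α : σ →₀ ℕ, α.degree < n → UnivModule.d k n (MvPolynomial.monomial α 1 * f) ∈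
        m • (⊤ : Submodule (MvPolynomial σ k) (UnivModule k (MvPolynomial σ k) n))) :
    relations k f n ≤ m.map (Ideal.Quotient.mk (Ideal.span {f})) •
      (⊤ : Submodule (MvPolynomial σ k ⧸ Ideal.span {f}) (Reduction k f n)) := by
  -- The hypothesis only concerns |α| < n, and these exponents already generate the relations.
  rw [relations_eq_span, Submodule.span_le]
  rintro _ ⟨α, hα, rfl⟩
  have key : ∀ x ∈ m • (⊤ : Submodule (MvPolynomial σ k) (UnivModule k (MvPolynomial σ k) n)),
      (Submodule.mkQ _ x : Reduction k f n) ∈ m.map (Ideal.Quotient.mk (Ideal.span {f})) •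
        (⊤ : Submodule (MvPolynomial σ k ⧸ Ideal.span {f}) (Reduction k f n)) := by
    intro x hx
    refine Submodule.smul_induction_on hx (fun r hr y _ => ?_) fun x y hx hy => ?_
    · exact Submodule.smul_mem_smul (r := Ideal.Quotient.mk (Ideal.span {f}) r)
        (n := (Submodule.mkQ _ y : Reduction k f n)) (Ideal.mem_map_of_mem _ hr) trivial
    · rw [map_add]
      exact add_mem hx hy
  exact key _ (hd α hα)

theorem mainTheorem1 {k : Type*} [Field k] [IsAlgClosed k] [CharZero k] (s n : ℕ)
    (m : Ideal (MvPolynomial (Fin s) k)) (hm : m.IsMaximal)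
    (f : MvPolynomial (Fin s) k) (hf : Irreducible f) (hfm : f ∈ m)
    (hd : ∀ α : Fin s →₀ ℕ, α.degree < n →
      UnivModule.d k n (MvPolynomial.monomial α 1 * f) ∈
        m • (⊤ : Submodule (MvPolynomial (Fin s) k)
          (UnivModule k (MvPolynomial (Fin s) k) n))) :
    ∃ _ : (m.map (Ideal.Quotient.mk (Ideal.span {f}))).IsMaximal,
      IsMinimalFreeResolution
        (Localization.AtPrime (m.map (Ideal.Quotient.mk (Ideal.span {f}))))
        (LocalizedModule.map (m.map (Ideal.Quotient.mk (Ideal.span {f}))).primeCompl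
          (UnivModule.relations k f n).subtype)
        (LocalizedModule.map (m.map (Ideal.Quotient.mk (Ideal.span {f}))).primeCompl
          (UnivModule.reductionMap k f n)) ∧
      Module.finrank (Localization.AtPrime (m.map (Ideal.Quotient.mk (Ideal.span {f}))))
        (LocalizedModule (m.map (Ideal.Quotient.mk (Ideal.span {f}))).primeCompl
          (UnivModule.relations k f n)) = (n + s - 1).choose s ∧
      Module.finrank (Localization.AtPrime (m.map (Ideal.Quotient.mk (Ideal.span {f}))))
        (LocalizedModule (m.map (Ideal.Quotient.mk (Ideal.span {f}))).primeCompl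
          (UnivModule.Reduction k f n)) = (n + s).choose s - 1 := by
  -- With no variables there would be no partial derivative outside (f).
  have hs : s ≠ 0 := by
    rintro rfl
    obtain ⟨i, -⟩ := MvPolynomial.exists_pderiv_notMem_span hf
    exact i.elim0
  have hprime : (Ideal.span {f}).IsPrime := (Ideal.span_singleton_prime hf.ne_zero).2 hf.prime
  have hmax : (m.map (Ideal.Quotient.mk (Ideal.span {f}))).IsMaximal := by
    refine Ideal.IsMaximal.map_of_surjective_of_ker_le Ideal.Quotient.mk_surjective ?_
    rw [Ideal.mk_ker, Ideal.span_le, Set.singleton_subset_iff]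
    exact hfm
  have e₁ := UnivModule.relationsEquiv f n hf
  have e₀ := UnivModule.reductionEquiv f n
  have := Module.Free.of_equiv e₁.symm
  have := Module.Finite.equiv e₁.symm
  have := Module.Free.of_equiv e₀.symm
  have := Module.Finite.equiv e₀.symm
  refine ⟨hmax, isMinimalFreeResolution_localizedModule _ (Submodule.subtype_injective _)
    (UnivModule.exact_reductionMap f n) (UnivModule.reductionMap_surjective f n) ?_, ?_, ?_⟩
  · rw [Submodule.range_subtype]
    exact UnivModule.relations_le_smul_top hd
  · refine (Module.finrank_of_isLocalizedModule_of_free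
      (Localization.AtPrime (m.map (Ideal.Quotient.mk (Ideal.span {f}))))
      (m.map (Ideal.Quotient.mk (Ideal.span {f}))).primeCompl
      (LocalizedModule.mkLinearMap _ (UnivModule.relations k f n))).trans ?_
    rw [e₁.finrank_eq,
      Module.finrank_fintype_fun_eq_card, Fintype.card_coe, card_exponentsBelow hs]
  · refine (Module.finrank_of_isLocalizedModule_of_free
      (Localization.AtPrime (m.map (Ideal.Quotient.mk (Ideal.span {f}))))
      (m.map (Ideal.Quotient.mk (Ideal.span {f}))).primeCompl
      (LocalizedModule.mkLinearMap _ (UnivModule.Reduction k f n))).trans ?_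
    rw [e₀.finrank_eq,
      Module.finrank_fintype_fun_eq_card, Fintype.card_coe, card_exponentsBelow_erase_zero]
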